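/- **Proposition.** Let $n\ge 1$, $\varepsilon>0$, $K\ge 1$ and $C>0$. There is a constant $c>0$ depending only on $n,\varepsilon,K,C$ such that the following holds. Let $(u_j)$ be an orthonormal basis of the space of Maass cusp forms for $SL_n(\mathbb Z)$ on $SL_n(\mathbb R)/SO_n(\mathbb R)$ consisting of Hecke–Maass forms, each even or odd. Suppose that all $u_j$ are tempered: $u_j$ has Langlands parameters $(i\beta_{1,j},\dots,i\beta_{n,j})$ with $\beta_j=(\beta_{1,j},\dots,\beta_{n,j})\in\mathbb R^n$, $\sum_l\beta_{l,j}=0$. Let $B_j(1)$ be the first Fourier coefficient of $u_j$, i.e. $$\int_{U_n(\mathbb Z)\backslash U_n(\mathbb R)}u_j(xz)\,\overline{\psi(x)}\,dx=B_j(1)\,W_J(z,i\beta_j),\qquad \psi(x)=e^{2\pi i(x_{1,2}+\dots+x_{n-1,n})},$$ where $U_n$ is the group of upper triangular unipotent matrices and $W_J$ is Jacquet's Whittaker function (not completed by gamma factors). Suppose that the lower bound in the weighted local Weyl law holds: for every $\lambda\in\mathbb R^n$ with $\lambda_1+\dots+\lambda_n=0$, $$C\prod_{1\le k<l\le n}(1+|\lambda_k-\lambda_l|)\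 \le \sum_{\substack{j:\ u_j\text{ even}\\ \|\beta_j-\lambda\|\le K}}|B_j(1)|^2,$$ where $\|\beta_j-\lambda\|\le K$ means that it holds, in the Euclidean norm, for some ordering of the entries of $\beta_j$. Let $F$ be an even Hecke–Maass cusp form for $SL_{n+1}(\mathbb Z)$ that is tempered, with Langlands parameters $(i\alpha_1,\dots,i\alpha_{n+1})$, $\alpha_k\in\mathbb R$, $\sum_k\alpha_k=0$, and Laplace eigenvalue $\lambda(F)=\frac{(n+1)^3-(n+1)}{24}+\frac12(\alpha_1^2+\dots+\alpha_{n+1}^2)$. If $|\alpha_j-\alpha_k|\ge\lambda(F)^{\varepsilon}$ for all $j\ne k$, then $$\sum_{j}{}^{*}\ |B_j(1)|^2\int_{-\infty}^{\infty}q(t,\alpha,\beta_j)\,dt\ \ge\ c,$$ where $*$ restricts the sum to the $u_j$ of the same parity as $F$, and $$q(t,\alpha,\beta)=\frac{\prod_{l=1}^{n}\prod_{k=1}^{n+1}\left|\Gamma\!\left(\frac{1/2+it+i\alpha_k+i\beta_l}{2}\right)\right|^2}{\prod_{1\le k<l\le n+1}\left|\Gamma\!\left(\frac{1+i\alpha_k-i\alpha_l}{2}\right)\right|^2\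 \prod_{1\le k<l\le n}\left|\Gamma\!\left(\frac{1+i\beta_k-i\beta_l}{2}\right)\right|^2}.$$ (For $n=1$ the space of cusp forms consists of the constants.) -/

import Mathlib

open scoped ContDiff

noncomputable section

namespace SLMaass

open MeasureTheory Filter Topology

/-- Real `n × n` matrices.  Functions on `GL_n(ℝ)` are written as functions on all matrices of
which only the values at invertible matrices are ever used. -/
abbrev Mat (n : ℕ) := Matrix (Fin n) (Fin n) ℝ

/-- An integral matrix, seen as a real one. -/
def toReal {n : ℕ} (A : Matrix (Fin n) (Fin n) ℤ) : Mat n := A.map (fun m => (m : ℝ))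

/-! ### Invariant differential operators -/

/-- `f` is smooth on the open set `GL_n(ℝ)` of the space of matrices. -/
def IsSmooth {n : ℕ} (f : Mat n → ℂ) : Prop :=
  ContDiffOn ℝ ∞ (fun x : Fin n → Fin n → ℝ => f (Matrix.of x))
    {x | (Matrix.of x : Mat n).det ≠ 0}

/-- The left-invariant vector field `D_X`, `X ∈ gl_n(ℝ)`:
`(D_X f)(g) = d/dt f(g + t g X)` at `t = 0`, which is also `d/dt f(g exp(t X))` at `t = 0`. -/
def vectorField {n : ℕ} (X : Mat n) (f : Mat n → ℂ) : Mat n → ℂ :=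
  fun g => deriv (fun t : ℝ => f (g + t • (g * X))) 0

/-- A complex linear combination `P` of words in `gl_n(ℝ)` acts as a differential operator: the word
`[X₁, …, X_m]` acts as `D_{X₁} ∘ ⋯ ∘ D_{X_m}`. -/
def applyOp {n : ℕ} (P : List (Mat n) →₀ ℂ) (f : Mat n → ℂ) : Mat n → ℂ :=
  fun g => P.sum fun w a => a * (w.foldr vectorField f) g

/-- `P` lies in the centre of the algebra of differential operators generated by the `D_X`. -/
def IsCentralOp {n : ℕ} (P : List (Mat n) →₀ ℂ) : Prop :=
  ∀ (X : Mat n) (f : Mat n → ℂ), IsSmooth f → ∀ g : Mat n, g.det ≠ 0 →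
    applyOp P (vectorField X f) g = vectorField X (applyOp P f) g

/-! ### Power functions and Langlands parameters -/

/-- The determinant of the lower right block, on the indices `≥ k`, of `g gᵀ`. If `g` is an upper
triangular unipotent matrix times `diag(a₀, …, a_{n-1})` times an orthogonal matrix, this is
`∏_{i ≥ k} a_i ^ 2`. -/
def tailGram {n : ℕ} (g : Mat n) (k : ℕ) : ℝ :=
  ((g * g.transpose).submatrix (fun i : {i : Fin n // k ≤ i.val} => i.val)
    (fun i : {i : Fin n // k ≤ i.val} => i.val)).det

/-- The `k`-th diagonal entry `a_k > 0` in the Iwasawa decomposition of `g`. -/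
def iwasawaDiag {n : ℕ} (g : Mat n) (k : Fin n) : ℝ :=
  Real.sqrt (tailGram g k.val / tailGram g (k.val + 1))

/-- The function `g ↦ ∏_k a_k ^ ((1 + δ) ρ_k + ℓ_k)`, with `ρ_k = (n - 1 - 2 k) / 2` for
`k = 0, …, n - 1`. For `ℓ` of sum zero this is `I_ν`, where
`ν_k = (1 + δ + ℓ_k - ℓ_{k+1}) / n`. -/
def powerFunction {n : ℕ} (ℓ : Fin n → ℂ) (δ : ℝ) (g : Mat n) : ℂ :=
  ∏ k : Fin n, ((iwasawaDiag g k : ℝ) : ℂ) ^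
    ((((1 + δ) * (((n : ℝ) - 1 - 2 * (k.val : ℝ)) / 2) : ℝ) : ℂ) + ℓ k)

/-- `f` has Langlands parameters `ℓ = (ℓ_1, …, ℓ_n)`, of sum zero: every operator in the centre
acts on `f` by the scalar by which it acts on the power function of parameter `ℓ`. -/
def HasLanglandsParameters {n : ℕ} (f : Mat n → ℂ) (ℓ : Fin n → ℂ) : Prop :=
  ∑ k, ℓ k = 0 ∧ ∀ P : List (Mat n) →₀ ℂ, IsCentralOp P → ∃ c : ℂ,
    (∀ g : Mat n, g.det ≠ 0 → applyOp P (powerFunction ℓ 0) g = c * powerFunction ℓ 0 g) ∧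
    (∀ g : Mat n, g.det ≠ 0 → applyOp P f g = c * f g)

/-- The purely imaginary vector `i β`; these are the parameters of tempered forms. -/
def imag {n : ℕ} (β : Fin n → ℝ) : Fin n → ℂ := fun k => Complex.I * (β k : ℂ)

/-! ### Coordinates on the symmetric space, and the quotient by `SL_n(ℤ)` -/

/-- The positions strictly above the diagonal blocks, for blocks given by the fibres of a monotone
`b`. For `b = Fin.val` these are all positions strictly above the diagonal. -/
abbrev UpperIdx {n : ℕ} (b : Fin n → ℕ) := {p : Fin n × Fin n // b p.1 < b p.2}

/-- The block upper triangular unipotent matrix with the entries `x` above the blocks. -/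
def unipotent {n : ℕ} (b : Fin n → ℕ) (x : UpperIdx b → ℝ) : Mat n :=
  1 + Matrix.of fun i j => if h : b i < b j then x ⟨(i, j), h⟩ else 0

/-- `diag(y_1 ⋯ y_{n-1}, …, y_1 y_2, y_1, 1)`, where the index of `y` starts at `0`. -/
def diagY {n : ℕ} (y : Fin (n - 1) → ℝ) : Mat n :=
  Matrix.diagonal fun i =>
    ∏ k ∈ Finset.univ.filter (fun k : Fin (n - 1) => k.val + i.val < n - 1), y k

/-- Coordinates `(x, y)` on `GL_n(ℝ) / (O_n(ℝ) ℝ^×) = SL_n(ℝ) / SO_n(ℝ)`, where `y > 0`. -/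
abbrev Point (n : ℕ) := (UpperIdx (fun i : Fin n => i.val) → ℝ) × (Fin (n - 1) → ℝ)

/-- The points with all `y_k > 0`. -/
def upperSpace (n : ℕ) : Set (Point n) := {p | ∀ k, 0 < p.2 k}

/-- The matrix with coordinates `(x, y)`. -/
def Point.toMat {n : ℕ} (p : Point n) : Mat n := unipotent (fun i : Fin n => i.val) p.1 * diagY p.2

/-- The invariant measure `∏ dx_{i,j} ∏_{k=1}^{n-1} y_k ^ (-k (n - k) - 1) dy_k`. -/
def invMeasure (n : ℕ) : Measure (Point n) :=
  (volume.restrict (upperSpace n)).withDensity fun p =>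
    ENNReal.ofReal (∏ k : Fin (n - 1), (p.2 k ^ ((k.val + 1) * (n - (k.val + 1)) + 1))⁻¹)

/-- Two points lie in the same orbit of `SL_n(ℤ)` on the symmetric space. -/
def Equivalent {n : ℕ} (p p' : Point n) : Prop :=
  ∃ (γ : Matrix.SpecialLinearGroup (Fin n) ℤ) (r : ℝ), r ≠ 0 ∧
    ∃ κ ∈ Matrix.orthogonalGroup (Fin n) ℝ,
      toReal (γ : Matrix (Fin n) (Fin n) ℤ) * p.toMat = r • (p'.toMat * κ)

/-- `D` is a measurable fundamental domain for `SL_n(ℤ)` acting on the symmetric space: it meets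
every orbit, and almost every point of `D` is the only point of `D` in its orbit. -/
structure IsFundDomain {n : ℕ} (D : Set (Point n)) : Prop where
  measurable : MeasurableSet D
  subset : D ⊆ upperSpace n
  covers : ∀ p ∈ upperSpace n, ∃ p' ∈ D, Equivalent p p'
  unique : ∀ᵐ p ∂((invMeasure n).restrict D), ∀ p' ∈ D, Equivalent p p' → p' = p

/-- The inner product of `L²(SL_n(ℤ) \ SL_n(ℝ) / SO_n(ℝ))`, computed on the fundamental domain
`D`. -/
def innerOn {n : ℕ} (D : Set (Point n)) (u v : Mat n → ℂ) : ℂ :=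
  ∫ p in D, u p.toMat * (starRingEnd ℂ) (v p.toMat) ∂(invMeasure n)

/-! ### Hecke-Maass forms -/

/-- `u` is a function on `SL_n(ℤ) \ GL_n(ℝ) / (O_n(ℝ) ℝ^×)`. -/
structure IsAutomorphic {n : ℕ} (u : Mat n → ℂ) : Prop where
  left : ∀ (γ : Matrix.SpecialLinearGroup (Fin n) ℤ) (g : Mat n), g.det ≠ 0 →
    u (toReal (γ : Matrix (Fin n) (Fin n) ℤ) * g) = u g
  right : ∀ κ ∈ Matrix.orthogonalGroup (Fin n) ℝ, ∀ g : Mat n, g.det ≠ 0 → u (g * κ) = u g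
  scalar : ∀ (r : ℝ) (g : Mat n), r ≠ 0 → g.det ≠ 0 → u (r • g) = u g

/-- All the constant terms of `u`, along the unipotent radicals of the proper standard parabolic
subgroups, vanish. -/
def IsCuspidal {n : ℕ} (u : Mat n → ℂ) : Prop :=
  ∀ b : Fin n → ℕ, Monotone b → (∃ i j, b i < b j) → ∀ g : Mat n, g.det ≠ 0 →
    ∫ x in Set.Icc (0 : UpperIdx b → ℝ) 1, u (unipotent b x * g) = 0

/-- Maass cusp forms for `SL_n(ℤ)`. -/
structure IsMaassForm {n : ℕ} (u : Mat n → ℂ) : Prop where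
  smooth : IsSmooth u
  automorphic : IsAutomorphic u
  sqIntegrable : ∃ D : Set (Point n), IsFundDomain D ∧
    IntegrableOn (fun p : Point n => ‖u p.toMat‖ ^ 2) D (invMeasure n)
  cuspidal : IsCuspidal u
  eigenfunction : ∃ ℓ : Fin n → ℂ, HasLanglandsParameters u ℓ
  ne_zero : ∃ g : Mat n, g.det ≠ 0 ∧ u g ≠ 0

/-- Representatives, in Hermite normal form, of `SL_n(ℤ)` acting on the left on the integral
matrices of determinant `N`. -/
def hermiteReps (n N : ℕ) : Set (Matrix (Fin n) (Fin n) ℤ) :=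
  {A | (∀ i j, j < i → A i j = 0) ∧ (∀ i, 0 < A i i) ∧ ∏ i, A i i = (N : ℤ) ∧
    ∀ i j, i < j → 0 ≤ A i j ∧ A i j < A j j}

/-- The Hecke operator `T_N`. -/
def hecke {n : ℕ} (N : ℕ) (u : Mat n → ℂ) : Mat n → ℂ := fun g =>
  (((N : ℝ) ^ (-((n : ℝ) - 1) / 2) : ℝ) : ℂ) * ∑ᶠ A ∈ hermiteReps n N, u (toReal A * g)

/-- Maass cusp forms that are eigenfunctions of all the Hecke operators. -/
structure IsHeckeMaassForm {n : ℕ} (u : Mat n → ℂ) : Prop where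
  maass : IsMaassForm u
  eigen : ∀ N : ℕ, 0 < N → ∃ c : ℂ, ∀ g : Mat n, g.det ≠ 0 → hecke N u g = c * u g

/-- Even forms: those invariant under the integral matrices of determinant `-1`, equivalently
those whose Fourier coefficients do not change when the last index changes its sign. -/
def IsEven {n : ℕ} (u : Mat n → ℂ) : Prop :=
  ∀ A : Matrix (Fin n) (Fin n) ℤ, A.det = -1 → ∀ g : Mat n, g.det ≠ 0 → u (toReal A * g) = u g

/-- Odd forms. -/
def IsOdd {n : ℕ} (u : Mat n → ℂ) : Prop :=
  ∀ A : Matrix (Fin n) (Fin n) ℤ, A.det = -1 → ∀ g : Mat n, g.det ≠ 0 → u (toReal A * g) = -u g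

/-- Both forms are even, or both are odd. -/
def SameParity {m n : ℕ} (F : Mat m → ℂ) (u : Mat n → ℂ) : Prop :=
  (IsEven F ∧ IsEven u) ∨ (IsOdd F ∧ IsOdd u)

/-- `u` is an orthonormal basis of the space of cusp forms for `SL_n(ℤ)` that consists of
Hecke-Maass forms, each of them even or odd. -/
def IsHeckeMaassBasis {n : ℕ} {ι : Type*} (u : ι → Mat n → ℂ) : Prop :=
  (∀ j, IsHeckeMaassForm (u j)) ∧ (∀ j, IsEven (u j) ∨ IsOdd (u j)) ∧
  ∃ D : Set (Point n), IsFundDomain D ∧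
    (∀ j, innerOn D (u j) (u j) = 1) ∧
    (∀ i j, i ≠ j → innerOn D (u i) (u j) = 0) ∧
    (∀ φ : Mat n → ℂ, IsMaassForm φ → ∃ j, innerOn D φ (u j) ≠ 0)

/-! ### The first Fourier coefficient -/

/-- The character `e(x_{1,2} + x_{2,3} + ⋯ + x_{n-1,n})` of the upper triangular unipotent group. -/
def unipotentChar {n : ℕ} (x : UpperIdx (fun i : Fin n => i.val) → ℝ) : ℂ :=
  Complex.exp (2 * Real.pi * Complex.I *
    ((∑ p : UpperIdx (fun i : Fin n => i.val),
      if p.1.2.val = p.1.1.val + 1 then x p else 0 : ℝ) : ℂ))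

/-- The long Weyl element. Signs of its entries play no role below. -/
def longWeyl (n : ℕ) : Mat n := Matrix.of fun i j => if j = Fin.rev i then 1 else 0

/-- Jacquet's integral at `ν_k = (1 + δ + ℓ_k - ℓ_{k+1}) / n`; for imaginary `ℓ` it converges
absolutely when `δ > 0`. -/
def jacquetIntegral {n : ℕ} (ℓ : Fin n → ℂ) (δ : ℝ) (g : Mat n) : ℂ :=
  ∫ x : UpperIdx (fun i : Fin n => i.val) → ℝ,
    powerFunction ℓ δ (longWeyl n * unipotent (fun i : Fin n => i.val) x * g) *
      (starRingEnd ℂ) (unipotentChar x)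

/-- `W` is Jacquet's Whittaker function of imaginary parameter `ℓ`. This parameter lies on the
boundary of the region of absolute convergence, and the value of the (entire) continuation there is
the limit of Jacquet's integral from inside the region. -/
def IsJacquetWhittaker {n : ℕ} (ℓ : Fin n → ℂ) (W : Mat n → ℂ) : Prop :=
  ∀ g : Mat n, g.det ≠ 0 →
    Tendsto (fun δ : ℝ => jacquetIntegral ℓ δ g) (𝓝[>] 0) (𝓝 (W g))

/-- `B` is the first Fourier coefficient of `u`, a form with imaginary Langlands parameter `ℓ`. -/
def IsFirstFourierCoeff {n : ℕ} (u : Mat n → ℂ) (ℓ : Fin n → ℂ) (B : ℂ) : Prop :=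
  ∃ W : Mat n → ℂ, IsJacquetWhittaker ℓ W ∧ ∀ g : Mat n, g.det ≠ 0 →
    ∫ x in Set.Icc (0 : UpperIdx (fun i : Fin n => i.val) → ℝ) 1,
      u (unipotent (fun i : Fin n => i.val) x * g) * (starRingEnd ℂ) (unipotentChar x) = B * W g

/-! ### The weighted local Weyl law, and the ratio of gamma factors -/

/-- `μ(λ) = ∏_{k < l} (1 + |λ_k - λ_l|)`. -/
def plancherelWeight {n : ℕ} (lam : Fin n → ℝ) : ℝ :=
  ∏ k : Fin n, ∏ l ∈ Finset.Ioi k, (1 + |lam k - lam l|)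

/-- The lower bound in the weighted local Weyl law, with radius `K` and implied constant `C`, for
the forms `u_j` of Langlands parameters `i β_j` and first Fourier coefficients `B_j`. The entries of
`β_j` have no preferred order, so `β_j` counts as close to `λ` when it is so in some order. -/
def WeightedWeylLower {n : ℕ} {ι : Type*} (u : ι → Mat n → ℂ) (β : ι → Fin n → ℝ) (B : ι → ℂ)
    (K C : ℝ) : Prop :=
  ∀ lam : Fin n → ℝ, ∑ k, lam k = 0 →
    ENNReal.ofReal (C * plancherelWeight lam) ≤
      ∑' j : {j : ι // IsEven (u j) ∧ ∃ σ : Equiv.Perm (Fin n),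
          Real.sqrt (∑ k, (β j (σ k) - lam k) ^ 2) ≤ K},
        ENNReal.ofReal (‖B j.val‖ ^ 2)

/-- The Laplace eigenvalue of a form on `SL_m(ℤ)` of Langlands parameters `i α`. -/
def laplaceEigenvalue {m : ℕ} (α : Fin m → ℝ) : ℝ :=
  ((m : ℝ) ^ 3 - (m : ℝ)) / 24 + 1 / 2 * ∑ k, α k ^ 2

/-- `∏_{k < l} |Γ((1 + i α_k - i α_l) / 2)|²`. -/
def gammaDenom {m : ℕ} (α : Fin m → ℝ) : ℝ :=
  ∏ k : Fin m, ∏ l ∈ Finset.Ioi k,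
    ‖Complex.Gamma ((1 + Complex.I * (α k : ℂ) - Complex.I * (α l : ℂ)) / 2)‖ ^ 2

/-- The ratio of gamma factors `q(t, α, β)`. -/
def gammaRatio {n : ℕ} (t : ℝ) (α : Fin (n + 1) → ℝ) (β : Fin n → ℝ) : ℝ :=
  (∏ l : Fin n, ∏ k : Fin (n + 1),
    ‖Complex.Gamma ((1 / 2 + Complex.I * (t : ℂ) + Complex.I * (α k : ℂ)
      + Complex.I * (β l : ℂ)) / 2)‖ ^ 2) /
    (gammaDenom α * gammaDenom β)

end SLMaass

end

namespace SLMaass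

/-! ### Elementary bounds of Stirling type for the gamma function on vertical lines -/

section GammaBounds

open Filter Topology
open scoped Nat

/-! By Stirling, `gammaRatio t α β` is at least a constant times `gammaRatioModel t α β`
(`exists_le_gammaRatio`). Its exponent compares the distances between the entries of `α` and of `-(t
+ β)` with the distances inside each of the two vectors. For sorted interlacing vectors the two
totals agree (`sum_abs_sub_of_interlacing`), so there is no exponential decay. Within a bounded
distance `R` of an interlacing `γ` only a constant is lost, and the ratio is `≫ interlacingWeight α
γ` (`exists_le_gammaRatioModel`).

Let `γ` range over the box whose sides are the middle halves of the gaps of `α`. There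
`interlacingWeight α γ * plancherelWeight γ` is at least a constant over the volume of the box, as
soon as the gaps are bounded below (`exists_le_plancherelWeight_mul`). The Weyl law at the centred
vector `-γ` supplies forms of total weight `≫ plancherelWeight γ`. For each of them, `-(t + β_j)` is
near `γ` for a set of `t` of measure at least `1` (`one_le_volume_nearSet`). Integrating over the
box thus gives a lower bound independent of `α`.

Conversely, for fixed `t` and `β_j`, the `γ` near some ordering of `-(t + β_j)` have bounded volume.
Tonelli's theorem therefore bounds the averaged quantity by a constant times the sum of integrals of
`gammaRatio` (`lintegral_mul_volume_nearSet_le`). -/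

lemma norm_ofReal_add_I_mul_sq (x y : ℝ) : ‖(x : ℂ) + Complex.I * y‖ ^ 2 = x ^ 2 + y ^ 2 := by
  rw [← Complex.normSq_eq_norm_sq, mul_comm, Complex.normSq_add_mul_I]

lemma norm_gammaSeq (σ y : ℝ) {n : ℕ} (hn : 0 < n) :
    ‖Complex.GammaSeq (σ + Complex.I * y) n‖ =
      (n : ℝ) ^ σ * n ! / ∏ j ∈ Finset.range (n + 1), ‖((σ + j : ℝ) : ℂ) + Complex.I * y‖ := by
  have h1 : ‖(n : ℂ) ^ ((σ : ℂ) + Complex.I * y)‖ = (n : ℝ) ^ σ := by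
    rw [Complex.norm_natCast_cpow_of_pos hn]; simp
  rw [Complex.GammaSeq, norm_div, norm_mul, norm_prod, h1, Complex.norm_natCast]
  congr 1
  refine Finset.prod_congr rfl fun j _ => ?_
  push_cast
  congr 1
  ring

lemma norm_midpoint_le {M h : ℝ} (h0 : 0 < h) (hM : h < M) (y : ℝ) :
    ‖(M : ℂ) + Complex.I * y‖ ^ 2 * ((M - h) * (M + h)) ≤
      ‖((M - h : ℝ) : ℂ) + Complex.I * y‖ * ‖((M + h : ℝ) : ℂ) + Complex.I * y‖ * M ^ 2 := by
  have hM0 : 0 < M := h0.trans hM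
  have hA : 0 < (M - h) * (M + h) := mul_pos (by linarith) (by linarith)
  refine le_of_sq_le_sq ?_ (by positivity)
  simp only [mul_pow, norm_ofReal_add_I_mul_sq]
  have h1 : (M - h) * (M + h) ≤ M ^ 2 := by nlinarith [sq_nonneg h]
  have h2 : ((M - h) * (M + h)) ^ 2 ≤ M ^ 2 * M ^ 2 := by
    rw [sq]; exact mul_le_mul h1 h1 hA.le (by positivity)
  rw [mul_pow] at h2
  -- The terms free of `y` cancel; `h2` and `h4` handle the coefficients of `y ^ 2` and `y ^ 4`.
  have h3 := mul_le_mul_of_nonneg_left h2 (by positivity : 0 ≤ 2 * M ^ 2 * y ^ 2 + (y ^ 2) ^ 2)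
  have h4 : 0 ≤ M ^ 4 * y ^ 2 * h ^ 2 := by positivity
  nlinarith [h3, h4]

/-- Midpoint log-concavity of `σ ↦ |Γ(σ + iy)| / Γ(σ)`. In Euler's product its square is `∏ (1 + y²
/ (σ + j)²)⁻¹`, and `log (1 + y² / x²)` is convex in `x > 0`; `norm_midpoint_le` is this convexity
for one factor. -/
lemma norm_Gamma_midpoint {m h : ℝ} (h0 : 0 < h) (hm : h < m) (y : ℝ) :
    ‖Complex.Gamma (((m - h : ℝ) : ℂ) + Complex.I * y)‖ *
        ‖Complex.Gamma (((m + h : ℝ) : ℂ) + Complex.I * y)‖ * Real.Gamma m ^ 2 ≤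
      ‖Complex.Gamma ((m : ℂ) + Complex.I * y)‖ ^ 2 *
        (Real.Gamma (m - h) * Real.Gamma (m + h)) := by
  have T (s : ℂ) := (Complex.GammaSeq_tendsto_Gamma s).norm
  refine le_of_tendsto_of_tendsto
    (((T _).mul (T _)).mul ((Real.GammaSeq_tendsto_Gamma m).pow 2))
    (((T _).pow 2).mul ((Real.GammaSeq_tendsto_Gamma (m - h)).mul
      (Real.GammaSeq_tendsto_Gamma (m + h)))) ?_
  filter_upwards [eventually_gt_atTop 0] with n hn
  rw [norm_gammaSeq _ y hn, norm_gammaSeq _ y hn, norm_gammaSeq _ y hn]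
  have hn0 : (0 : ℝ) < n := by exact_mod_cast hn
  have hpow : (n : ℝ) ^ (m - h) * (n : ℝ) ^ (m + h) = ((n : ℝ) ^ m) ^ 2 := by
    rw [sq, ← Real.rpow_add hn0, ← Real.rpow_add hn0]; congr 1; ring
  have pos (x : ℝ) (hx : 0 < x) (j : ℕ) : 0 < ‖((x + j : ℝ) : ℂ) + Complex.I * y‖ := by
    have := norm_ofReal_add_I_mul_sq (x + j) y
    have h' : 0 < (x + j) ^ 2 + y ^ 2 := by positivity
    rw [← this] at h'
    exact (norm_nonneg _).lt_of_ne fun h0 => by rw [← h0] at h'; norm_num at h'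
  set P : ℝ → ℝ := fun x => ∏ j ∈ Finset.range (n + 1), ‖((x + j : ℝ) : ℂ) + Complex.I * y‖
  set R : ℝ → ℝ := fun x => ∏ j ∈ Finset.range (n + 1), (x + j)
  have hP (x : ℝ) (hx : 0 < x) : 0 < P x := Finset.prod_pos fun j _ => pos x hx j
  have hR (x : ℝ) (hx : 0 < x) : 0 < R x := Finset.prod_pos fun j _ => by positivity
  have key : P m ^ 2 * (R (m - h) * R (m + h)) ≤ P (m - h) * P (m + h) * R m ^ 2 := by
    simp only [P, R, ← Finset.prod_pow, ← Finset.prod_mul_distrib]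
    refine Finset.prod_le_prod (fun j _ => ?_) fun j _ => ?_
    · have h1 : 0 < m - h := by linarith
      have h2 : 0 < m + h := by linarith
      positivity
    · have hj : (0 : ℝ) ≤ j := j.cast_nonneg
      have := norm_midpoint_le h0 (show h < m + j by linarith) y
      rwa [show m + j - h = m - h + j by ring, show m + j + h = m + h + j by ring] at this
  have a1 := hP m (by linarith)
  have a2 := hP (m - h) (by linarith)
  have a3 := hP (m + h) (by linarith)
  have b1 := hR m (by linarith)
  have b2 := hR (m - h) (by linarith)
  have b3 := hR (m + h) (by linarith)
  simp only [Real.GammaSeq]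
  change (n : ℝ) ^ (m - h) * n ! / P (m - h) * ((n : ℝ) ^ (m + h) * n ! / P (m + h)) *
      ((n : ℝ) ^ m * n ! / R m) ^ 2 ≤
    ((n : ℝ) ^ m * n ! / P m) ^ 2 * ((n : ℝ) ^ (m - h) * n ! / R (m - h) *
      ((n : ℝ) ^ (m + h) * n ! / R (m + h)))
  have e1 : (n : ℝ) ^ (m - h) * n ! / P (m - h) * ((n : ℝ) ^ (m + h) * n ! / P (m + h)) *
      ((n : ℝ) ^ m * n ! / R m) ^ 2 =
      ((n : ℝ) ^ m) ^ 4 * (n ! : ℝ) ^ 4 * (P (m - h) * P (m + h) * R m ^ 2)⁻¹ := by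
    rw [show ((n : ℝ) ^ m) ^ 4 = (n : ℝ) ^ (m - h) * (n : ℝ) ^ (m + h) * ((n : ℝ) ^ m) ^ 2 by
      rw [hpow]; ring]
    field_simp
  have e2 : ((n : ℝ) ^ m * n ! / P m) ^ 2 * ((n : ℝ) ^ (m - h) * n ! / R (m - h) *
      ((n : ℝ) ^ (m + h) * n ! / R (m + h))) =
      ((n : ℝ) ^ m) ^ 4 * (n ! : ℝ) ^ 4 * (P m ^ 2 * (R (m - h) * R (m + h)))⁻¹ := by
    rw [show ((n : ℝ) ^ m) ^ 4 = (n : ℝ) ^ (m - h) * (n : ℝ) ^ (m + h) * ((n : ℝ) ^ m) ^ 2 by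
      rw [hpow]; ring]
    field_simp
  rw [e1, e2]
  gcongr

lemma norm_sq_Gamma_half (y : ℝ) :
    ‖Complex.Gamma (((1 / 2 : ℝ) : ℂ) + Complex.I * y)‖ ^ 2 = Real.pi / Real.cosh (Real.pi * y) := by
  have h := Complex.Gamma_mul_Gamma_one_sub (((1 / 2 : ℝ) : ℂ) + Complex.I * y)
  have hc : 1 - (((1 / 2 : ℝ) : ℂ) + Complex.I * y) =
      (starRingEnd ℂ) (((1 / 2 : ℝ) : ℂ) + Complex.I * y) := by
    simp only [map_add, map_mul, Complex.conj_ofReal, Complex.conj_I]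
    push_cast; ring
  have hs : Complex.sin (Real.pi * (((1 / 2 : ℝ) : ℂ) + Complex.I * y)) =
      ((Real.cosh (Real.pi * y) : ℝ) : ℂ) := by
    rw [show (Real.pi : ℂ) * (((1 / 2 : ℝ) : ℂ) + Complex.I * y) =
      ((Real.pi * y : ℝ) : ℂ) * Complex.I + Real.pi / 2 by push_cast; ring,
      Complex.sin_add_pi_div_two, Complex.cos_mul_I, Complex.ofReal_cosh]
  rw [hc, Complex.Gamma_conj, Complex.mul_conj, Complex.normSq_eq_norm_sq, hs,
    ← Complex.ofReal_div] at h
  exact_mod_cast h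

lemma norm_sq_Gamma_one {y : ℝ} (hy : y ≠ 0) :
    ‖Complex.Gamma (((1 : ℝ) : ℂ) + Complex.I * y)‖ ^ 2 =
      Real.pi * y / Real.sinh (Real.pi * y) := by
  have hIy : Complex.I * (y : ℂ) ≠ 0 := by simp [hy]
  have h := Complex.Gamma_mul_Gamma_one_sub (Complex.I * y)
  have hc : 1 - Complex.I * (y : ℂ) = (starRingEnd ℂ) (Complex.I * y + 1) := by
    simp only [map_add, map_mul, Complex.conj_ofReal, Complex.conj_I, map_one]
    ring
  have hs : Complex.sin (Real.pi * (Complex.I * y)) =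
      ((Real.sinh (Real.pi * y) : ℝ) : ℂ) * Complex.I := by
    rw [show (Real.pi : ℂ) * (Complex.I * y) = ((Real.pi * y : ℝ) : ℂ) * Complex.I by
      push_cast; ring, Complex.sin_mul_I, Complex.ofReal_sinh]
  have h2 := congrArg (fun z => Complex.I * (y : ℂ) * z) h
  simp only [← mul_assoc (Complex.I * (y : ℂ)) (Complex.Gamma _)] at h2
  have hsh : ((Real.sinh (Real.pi * y) : ℝ) : ℂ) ≠ 0 := by
    rw [Complex.ofReal_ne_zero, Ne, Real.sinh_eq_zero]
    exact mul_ne_zero Real.pi_ne_zero hy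
  rw [← Complex.Gamma_add_one _ hIy, hc, Complex.Gamma_conj, Complex.mul_conj,
    Complex.normSq_eq_norm_sq, hs] at h2
  have h3 : Complex.I * (y : ℂ) * (Real.pi / (((Real.sinh (Real.pi * y) : ℝ) : ℂ) * Complex.I)) =
      ((Real.pi * y / Real.sinh (Real.pi * y) : ℝ) : ℂ) := by
    push_cast at hsh ⊢
    field_simp [Complex.I_ne_zero]
  rw [h3, add_comm] at h2
  exact_mod_cast h2

lemma norm_sq_Gamma_half_le (y : ℝ) :
    ‖Complex.Gamma (((1 / 2 : ℝ) : ℂ) + Complex.I * y)‖ ^ 2 ≤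
      2 * Real.pi * Real.exp (-(Real.pi * |y|)) := by
  rw [norm_sq_Gamma_half, div_le_iff₀ (Real.cosh_pos _), ← Real.cosh_abs, abs_mul,
    abs_of_pos Real.pi_pos, Real.cosh_eq]
  have : Real.exp (-(Real.pi * |y|)) * Real.exp (Real.pi * |y|) = 1 := by
    rw [← Real.exp_add]; simp
  nlinarith [Real.pi_pos, Real.exp_pos (-(Real.pi * |y|)),
    mul_pos Real.pi_pos (pow_pos (Real.exp_pos (-(Real.pi * |y|))) 2)]

lemma le_norm_sq_Gamma_half (y : ℝ) :
    Real.exp (-(Real.pi * |y|)) ≤ ‖Complex.Gamma (((1 / 2 : ℝ) : ℂ) + Complex.I * y)‖ ^ 2 := by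
  rw [norm_sq_Gamma_half, le_div_iff₀ (Real.cosh_pos _), ← Real.cosh_abs, abs_mul,
    abs_of_pos Real.pi_pos, Real.cosh_eq]
  have h1 : Real.exp (-(Real.pi * |y|)) * Real.exp (Real.pi * |y|) = 1 := by
    rw [← Real.exp_add]; simp
  have h2 : Real.exp (-(Real.pi * |y|)) ≤ 1 := Real.exp_le_one_iff.2 (by
    have := Real.pi_pos; have := abs_nonneg y; nlinarith)
  nlinarith [Real.pi_gt_three, Real.exp_pos (-(Real.pi * |y|))]

lemma sinh_mul_one_add_le {x : ℝ} (hx : 0 ≤ x) : Real.sinh x * (1 + x) ≤ 2 * x * Real.exp x := by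
  have h1 : Real.exp (-x) * Real.exp x = 1 := by rw [← Real.exp_add]; simp
  have h2 := Real.add_one_le_exp (-(2 * x))
  have h3 : Real.exp (-(2 * x)) * Real.exp x = Real.exp (-x) := by rw [← Real.exp_add]; ring_nf
  have h4 := Real.exp_pos x
  have h5 := Real.exp_pos (-x)
  rw [Real.sinh_eq]
  have h6 : Real.exp x - Real.exp (-x) ≤ 2 * x * Real.exp x := by nlinarith
  have h7 : (Real.exp x - Real.exp (-x)) * x ≤ 2 * x * Real.exp x := by nlinarith
  linarith

lemma le_norm_sq_Gamma_one (y : ℝ) :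
    (1 + |y|) / 2 * Real.exp (-(Real.pi * |y|)) ≤
      ‖Complex.Gamma (((1 : ℝ) : ℂ) + Complex.I * y)‖ ^ 2 := by
  rcases eq_or_ne y 0 with rfl | hy
  · norm_num
  · have hy' : 0 < |y| := abs_pos.2 hy
    have e : Real.pi * y / Real.sinh (Real.pi * y) =
        Real.pi * |y| / Real.sinh (Real.pi * |y|) := by
      rcases abs_choice y with h | h <;> rw [h]
      rw [mul_neg, Real.sinh_neg, neg_div_neg_eq]
    have hpy : 0 < Real.pi * |y| := mul_pos Real.pi_pos hy'
    rw [norm_sq_Gamma_one hy, e, le_div_iff₀ (Real.sinh_pos_iff.2 hpy)]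
    have h1 := sinh_mul_one_add_le hpy.le
    have h2 : Real.exp (-(Real.pi * |y|)) * Real.exp (Real.pi * |y|) = 1 := by
      rw [← Real.exp_add]; simp
    have h3 := Real.sinh_pos_iff.2 hpy
    have h4 : Real.sinh (Real.pi * |y|) * (1 + |y|) ≤ 2 * (Real.pi * |y|) * Real.exp (Real.pi * |y|) :=
      (mul_le_mul_of_nonneg_left (by nlinarith [Real.pi_gt_three]) h3.le).trans h1
    have h5 := mul_le_mul_of_nonneg_left h4 (Real.exp_pos (-(Real.pi * |y|))).le
    have h6 : Real.exp (-(Real.pi * |y|)) * (2 * (Real.pi * |y|) * Real.exp (Real.pi * |y|)) =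
      2 * (Real.pi * |y|) := by rw [mul_left_comm, h2, mul_one]
    rw [h6] at h5
    linarith

/-- The reflection formula evaluates `|Γ|` on the lines of real part `1/2` and `1`, but not `1/4`.
Log-concavity interpolates from those lines, after a shift by `1`. -/
lemma exists_le_norm_sq_Gamma_quarter : ∃ c : ℝ, 0 < c ∧ ∀ y : ℝ,
    c * (Real.exp (-(Real.pi * |y|)) / Real.sqrt (1 + |y|)) ≤
      ‖Complex.Gamma (((1 / 4 : ℝ) : ℂ) + Complex.I * y)‖ ^ 2 := by
  set A := Real.Gamma (5 / 4) ^ 2 with hA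
  set D := Real.Gamma 1 * Real.Gamma (3 / 2) with hD
  have hA0 : 0 < A := pow_pos (Real.Gamma_pos_of_pos (by norm_num)) 2
  have hD0 : 0 < D :=
    mul_pos (Real.Gamma_pos_of_pos (by norm_num)) (Real.Gamma_pos_of_pos (by norm_num))
  refine ⟨A / (2 * D), by positivity, fun y => ?_⟩
  -- The endpoints are `1` and `3/2 = 1/2 + 1`, both explicit; the midpoint is `1/4 + 1`.
  have hmid := norm_Gamma_midpoint (m := 5 / 4) (h := 1 / 4) (by norm_num) (by norm_num) y
  norm_num only [← hA, ← hD] at hmid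
  have ne (x : ℝ) (hx : 0 < x) : ((x : ℝ) : ℂ) + Complex.I * y ≠ 0 := fun h => by
    have := congrArg Complex.re h
    simp at this; linarith
  have s1 : Complex.Gamma (((5 / 4 : ℝ) : ℂ) + Complex.I * y) =
      (((1 / 4 : ℝ) : ℂ) + Complex.I * y) *
        Complex.Gamma (((1 / 4 : ℝ) : ℂ) + Complex.I * y) := by
    rw [← Complex.Gamma_add_one _ (ne _ (by norm_num))]; congr 1; push_cast; ring
  have s2 : Complex.Gamma (((3 / 2 : ℝ) : ℂ) + Complex.I * y) =
      (((1 / 2 : ℝ) : ℂ) + Complex.I * y) *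
        Complex.Gamma (((1 / 2 : ℝ) : ℂ) + Complex.I * y) := by
    rw [← Complex.Gamma_add_one _ (ne _ (by norm_num))]; congr 1; push_cast; ring
  rw [s1, s2, norm_mul, norm_mul] at hmid
  have l1 := le_norm_sq_Gamma_one y
  have l2 := le_norm_sq_Gamma_half y
  have q1 := norm_ofReal_add_I_mul_sq (1 / 4) y
  have q2 := norm_ofReal_add_I_mul_sq (1 / 2) y
  set g := ‖Complex.Gamma (((1 / 4 : ℝ) : ℂ) + Complex.I * y)‖
  set g1 := ‖Complex.Gamma (((1 : ℝ) : ℂ) + Complex.I * y)‖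
  set g2 := ‖Complex.Gamma (((1 / 2 : ℝ) : ℂ) + Complex.I * y)‖
  set p := ‖((1 / 4 : ℝ) : ℂ) + Complex.I * y‖
  set r := ‖((1 / 2 : ℝ) : ℂ) + Complex.I * y‖
  set E := Real.exp (-(Real.pi * |y|)) with hE
  have hE0 : 0 < E := Real.exp_pos _
  have hay := abs_nonneg y
  have hp0 : 0 < p := norm_pos_iff.2 (ne _ (by norm_num))
  have hpr : p ≤ r := le_of_sq_le_sq (by rw [q1, q2]; linarith) (norm_nonneg _)
  have hp1 : p ≤ 1 + |y| := le_of_sq_le_sq (by rw [q1, ← sq_abs y]; nlinarith) (by positivity)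
  set S := Real.sqrt (1 + |y|)
  have hS0 : 0 < S := Real.sqrt_pos.2 (by linarith)
  have hS : S ^ 2 = 1 + |y| := Real.sq_sqrt (by linarith)
  have h12 : S / 2 * E ≤ g1 * g2 := by
    refine le_of_sq_le_sq ?_ (mul_nonneg (norm_nonneg _) (norm_nonneg _))
    have := mul_le_mul l1 l2 hE0.le (sq_nonneg _)
    rw [mul_pow, mul_pow, div_pow, hS]
    nlinarith [mul_pos hE0 hE0]
  have h3 : S / 2 * E * p * A ≤ (p * g) ^ 2 * D := by
    refine le_trans ?_ hmid
    have := mul_le_mul h12 hpr hp0.le (mul_nonneg (norm_nonneg _) (norm_nonneg _))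
    have := mul_le_mul_of_nonneg_right this hA0.le
    linarith
  have h4 : S / 2 * E * A ≤ p * g ^ 2 * D := by
    refine le_of_mul_le_mul_right ?_ hp0
    linarith
  -- The shift factor `p` is at most `S ^ 2`; against the `S` on the left this leaves the loss `1 /
  -- S`.
  have h5 : S / 2 * E * A ≤ S ^ 2 * g ^ 2 * D := by
    refine h4.trans ?_
    rw [hS]
    gcongr
  have h6 : E * A ≤ 2 * D * g ^ 2 * S := by
    refine le_of_mul_le_mul_right ?_ hS0
    linarith
  rw [div_mul_div_comm, div_le_iff₀ (by positivity)]
  linarith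

end GammaBounds

end SLMaass

namespace SLMaass

/-! ### Sums of distances for sorted and interlacing vectors -/

section Interlacing

open Finset

/-- The sum of all distances between entries of `x`, each pair being counted twice. -/
noncomputable def spread {m : ℕ} (x : Fin m → ℝ) : ℝ := ∑ k, ∑ l, |x k - x l|

lemma spread_comp_perm {m : ℕ} (x : Fin m → ℝ) (σ : Equiv.Perm (Fin m)) :
    spread (x ∘ σ) = spread x := by
  unfold spread
  rw [← Equiv.sum_comp σ fun k => ∑ l, |x k - x l|]
  exact sum_congr rfl fun k _ => Equiv.sum_comp σ fun l => |x (σ k) - x l|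

lemma sum_Ioi_eq_sum_ite {m : ℕ} (f : Fin m → Fin m → ℝ) :
    ∑ k, ∑ l ∈ Ioi k, f k l = ∑ k, ∑ l, if k < l then f k l else 0 := by
  refine sum_congr rfl fun k _ => ?_
  rw [← sum_filter]
  exact sum_congr (by ext; simp) fun _ _ => rfl

lemma sum_Ioi_abs_sub {m : ℕ} (x : Fin m → ℝ) :
    ∑ k, ∑ l ∈ Ioi k, |x k - x l| = spread x / 2 := by
  have h1 := sum_Ioi_eq_sum_ite fun k l => |x k - x l|
  have h2 : spread x = ∑ k, ∑ l, (if k < l then |x k - x l| else 0) +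
      ∑ l, ∑ k, (if k < l then |x k - x l| else 0) := by
    rw [spread, ← sum_add_distrib]
    refine sum_congr rfl fun k _ => ?_
    rw [← sum_add_distrib]
    refine sum_congr rfl fun l _ => ?_
    rcases lt_trichotomy k l with h | h | h
    · simp [h, h.le]
    · simp [h]
    · simp [h, h.le, abs_sub_comm]
  rw [sum_comm (s := univ) (t := univ) (f := fun l k => if k < l then |x k - x l| else 0),
    ← h1] at h2
  rw [h2]; ring

lemma sum_sign_lt {m : ℕ} {a : ℕ} (ha : a ≤ m) :
    ∑ l : Fin m, (if l.val < a then (1 : ℝ) else -1) = 2 * a - m := by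
  rw [Fin.sum_univ_eq_sum_range (fun l => if l < a then (1 : ℝ) else -1)]
  induction m, ha using Nat.le_induction with
  | base =>
    rw [sum_congr rfl fun l hl => if_pos (mem_range.1 hl)]
    simp; ring
  | succ m hm ih => rw [sum_range_succ, ih, if_neg (by omega)]; push_cast; ring

lemma sum_sign_gt {m : ℕ} {a : ℕ} (ha : a < m) :
    ∑ k : Fin m, (if a < k.val then (1 : ℝ) else -1) = m - 2 * (a + 1) := by
  have h := sum_sign_lt (m := m) (a := a + 1) ha
  rw [← neg_inj, ← sum_neg_distrib]
  push_cast at h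
  rw [show -((m : ℝ) - 2 * (a + 1)) = 2 * (a + 1) - m by ring, ← h]
  refine sum_congr rfl fun k _ => ?_
  split_ifs <;> first | omega | simp

/-- In a sorted vector the entry of index `k` has `k` entries before it and `m - 1 - k` after it,
and the difference of these counts is its coefficient. -/
lemma spread_of_monotone {m : ℕ} {x : Fin m → ℝ} (hx : Monotone x) :
    spread x / 2 = ∑ k : Fin m, x k * (2 * k.val + 1 - m) := by
  -- The diagonal terms get the sign `-1` in both halves and cancel.
  have h1 : spread x = ∑ k : Fin m, ∑ l : Fin m,
      (x k * (if l.val < k.val then (1 : ℝ) else -1) -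
        x l * (if l.val < k.val then (1 : ℝ) else -1)) := by
    refine sum_congr rfl fun k _ => sum_congr rfl fun l _ => ?_
    split_ifs with h
    · rw [abs_of_nonneg (sub_nonneg.2 (hx h.le))]; ring
    · rw [abs_of_nonpos (sub_nonpos.2 (hx (not_lt.1 h)))]; ring
  simp_rw [sum_sub_distrib] at h1
  rw [sum_comm (f := fun k l : Fin m => x l * (if l.val < k.val then (1 : ℝ) else -1))] at h1
  simp_rw [← mul_sum] at h1
  rw [h1, ← sum_sub_distrib, sum_div]
  refine sum_congr rfl fun k _ => ?_
  rw [sum_sign_lt k.isLt.le, sum_sign_gt k.isLt]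
  ring

/-- Count signs: `α k` has `k` of the `γ` below it and `n - k` above, while `γ l` has `l + 1` of the
`α` below it and `n - l - 1` above. These are the coefficients of `spread_of_monotone` for `α` and
for `γ`. -/
lemma sum_abs_sub_of_interlacing {n : ℕ} {α : Fin (n + 1) → ℝ} {γ : Fin n → ℝ}
    (h1 : ∀ l, α l.castSucc ≤ γ l) (h2 : ∀ l, γ l ≤ α l.succ) :
    ∑ l, ∑ k, |α k - γ l| = spread α / 2 + spread γ / 2 := by
  have hα : Monotone α := Fin.monotone_iff_le_succ.2 fun l => (h1 l).trans (h2 l)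
  have hγ : Monotone γ := fun j l hjl => by
    rcases hjl.eq_or_lt with rfl | h
    · rfl
    · exact (h2 j).trans ((hα (Fin.le_def.2 (by simpa using h))).trans (h1 l))
  have e : ∑ l, ∑ k, |α k - γ l| = ∑ l : Fin n, ∑ k : Fin (n + 1),
      (α k * (if l.val < k.val then (1 : ℝ) else -1) -
        γ l * (if l.val < k.val then (1 : ℝ) else -1)) := by
    refine sum_congr rfl fun l _ => sum_congr rfl fun k _ => ?_
    split_ifs with h
    · have : γ l ≤ α k := (h2 l).trans (hα (Fin.le_def.2 (by simpa using h)))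
      rw [abs_of_nonneg (sub_nonneg.2 this)]; ring
    · have : α k ≤ γ l := (hα (Fin.le_def.2 (by simpa using h))).trans (h1 l)
      rw [abs_of_nonpos (sub_nonpos.2 this)]; ring
  simp_rw [sum_sub_distrib] at e
  rw [sum_comm (f := fun (l : Fin n) (k : Fin (n + 1)) =>
    α k * (if l.val < k.val then (1 : ℝ) else -1))] at e
  simp_rw [← mul_sum] at e
  rw [e, spread_of_monotone hα, spread_of_monotone hγ, sub_eq_add_neg, ← sum_neg_distrib]
  congr 1
  · refine sum_congr rfl fun k _ => ?_
    rw [sum_sign_lt (Nat.lt_succ_iff.1 k.isLt)]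
    push_cast; ring
  · refine sum_congr rfl fun l _ => ?_
    rw [sum_sign_gt (l.isLt.trans (Nat.lt_succ_self n))]
    push_cast; ring

end Interlacing

/-! ### Lower bound for the ratio of gamma factors near interlacing vectors -/

section Minorant

open Finset

/-- `q(t, α, β)` with the gamma factors replaced by their size according to Stirling's formula. -/
noncomputable def gammaRatioModel {n : ℕ} (t : ℝ) (α : Fin (n + 1) → ℝ) (β : Fin n → ℝ) : ℝ :=
  (∏ l, ∏ k, (Real.sqrt (1 + |t + α k + β l|))⁻¹) *
    Real.exp (-(Real.pi / 2 * (∑ l, ∑ k, |t + α k + β l| - spread α / 2 - spread β / 2)))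

/-- This symmetry permits sorting `α` and choosing the order of `β` in which it is close to the
target. -/
lemma gammaRatioModel_comp_perm {n : ℕ} (t : ℝ) (α : Fin (n + 1) → ℝ) (β : Fin n → ℝ)
    (τ : Equiv.Perm (Fin (n + 1))) (σ : Equiv.Perm (Fin n)) :
    gammaRatioModel t (α ∘ τ) (β ∘ σ) = gammaRatioModel t α β := by
  unfold gammaRatioModel
  rw [spread_comp_perm, spread_comp_perm,
    ← Equiv.prod_comp σ fun l => ∏ k, (Real.sqrt (1 + |t + α k + β l|))⁻¹,
    ← Equiv.sum_comp σ fun l => ∑ k, |t + α k + β l|]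
  congr 1
  · refine prod_congr rfl fun l _ => ?_
    exact Equiv.prod_comp τ fun k => (Real.sqrt (1 + |t + α k + β (σ l)|))⁻¹
  · congr 5
    refine sum_congr rfl fun l _ => ?_
    exact Equiv.sum_comp τ fun k => |t + α k + β (σ l)|

lemma gammaDenom_pos {m : ℕ} (α : Fin m → ℝ) : 0 < gammaDenom α := by
  refine prod_pos fun k _ => prod_pos fun l _ => pow_pos (norm_pos_iff.2 ?_) 2
  refine Complex.Gamma_ne_zero_of_re_pos ?_
  rw [show (1 + Complex.I * (α k : ℂ) - Complex.I * (α l : ℂ)) / 2 =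
    ((1 / 2 : ℝ) : ℂ) + Complex.I * (((α k - α l) / 2 : ℝ) : ℂ) by push_cast; ring]
  simp

lemma gammaDenom_le {m : ℕ} (α : Fin m → ℝ) :
    gammaDenom α ≤ (∏ k : Fin m, ∏ _l ∈ Ioi k, 2 * Real.pi) *
      Real.exp (-(Real.pi / 2 * (spread α / 2))) := by
  rw [← sum_Ioi_abs_sub, mul_sum, ← sum_neg_distrib, Real.exp_sum, ← prod_mul_distrib]
  refine prod_le_prod (fun k _ => by positivity) fun k _ => ?_
  rw [mul_sum, ← sum_neg_distrib, Real.exp_sum, ← prod_mul_distrib]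
  refine prod_le_prod (fun l _ => by positivity) fun l _ => ?_
  rw [show (1 + Complex.I * (α k : ℂ) - Complex.I * (α l : ℂ)) / 2 =
    ((1 / 2 : ℝ) : ℂ) + Complex.I * (((α k - α l) / 2 : ℝ) : ℂ) by push_cast; ring]
  refine (norm_sq_Gamma_half_le _).trans (le_of_eq ?_)
  rw [abs_div, abs_two]
  ring_nf

lemma exists_le_gammaRatio (n : ℕ) : ∃ c : ℝ, 0 < c ∧
    ∀ (t : ℝ) (α : Fin (n + 1) → ℝ) (β : Fin n → ℝ),
      c * gammaRatioModel t α β ≤ gammaRatio t α β := by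
  obtain ⟨c, hc, hq⟩ := exists_le_norm_sq_Gamma_quarter
  set N : ℝ := ∏ _l : Fin n, ∏ _k : Fin (n + 1), c
  set A : ℝ := ∏ k : Fin (n + 1), ∏ _l ∈ Ioi k, 2 * Real.pi
  set B : ℝ := ∏ k : Fin n, ∏ _l ∈ Ioi k, 2 * Real.pi
  have hN : 0 < N := prod_pos fun _ _ => prod_pos fun _ _ => hc
  have hA : 0 < A := prod_pos fun _ _ => prod_pos fun _ _ => by positivity
  have hB : 0 < B := prod_pos fun _ _ => prod_pos fun _ _ => by positivity
  refine ⟨N / (A * B), by positivity, fun t α β => ?_⟩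
  have num : N * ((∏ l, ∏ k, (Real.sqrt (1 + |t + α k + β l|))⁻¹) *
      Real.exp (-(Real.pi / 2 * ∑ l, ∑ k, |t + α k + β l|))) ≤
      ∏ l : Fin n, ∏ k : Fin (n + 1), ‖Complex.Gamma ((1 / 2 + Complex.I * (t : ℂ) +
        Complex.I * (α k : ℂ) + Complex.I * (β l : ℂ)) / 2)‖ ^ 2 := by
    rw [mul_sum, ← sum_neg_distrib, Real.exp_sum, ← prod_mul_distrib, ← prod_mul_distrib]
    refine prod_le_prod (fun l _ => by positivity) fun l _ => ?_
    rw [mul_sum, ← sum_neg_distrib, Real.exp_sum, ← prod_mul_distrib, ← prod_mul_distrib]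
    refine prod_le_prod (fun k _ => by positivity) fun k _ => ?_
    rw [show (1 / 2 + Complex.I * (t : ℂ) + Complex.I * (α k : ℂ) + Complex.I * (β l : ℂ)) / 2 =
      ((1 / 4 : ℝ) : ℂ) + Complex.I * (((t + α k + β l) / 2 : ℝ) : ℂ) by push_cast; ring]
    refine le_trans ?_ (hq _)
    rw [abs_div, abs_two, show Real.pi * (|t + α k + β l| / 2) =
      Real.pi / 2 * |t + α k + β l| by ring, inv_mul_eq_div]
    have := abs_nonneg (t + α k + β l)
    gcongr
    linarith
  have den : gammaDenom α * gammaDenom β ≤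
      A * Real.exp (-(Real.pi / 2 * (spread α / 2))) *
        (B * Real.exp (-(Real.pi / 2 * (spread β / 2)))) :=
    mul_le_mul (gammaDenom_le α) (gammaDenom_le β) (gammaDenom_pos β).le (by positivity)
  refine le_trans (le_of_eq ?_) (div_le_div₀ (by positivity) num
    (mul_pos (gammaDenom_pos α) (gammaDenom_pos β)) den)
  rw [gammaRatioModel, show -(Real.pi / 2 * (∑ l, ∑ k, |t + α k + β l| - spread α / 2 -
      spread β / 2)) = -(Real.pi / 2 * ∑ l, ∑ k, |t + α k + β l|) -
      -(Real.pi / 2 * (spread α / 2)) - -(Real.pi / 2 * (spread β / 2)) by ring,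
    Real.exp_sub, Real.exp_sub]
  field_simp

/-- The size of the model of `q(t, α, β)` when `-(t + β)` is close to an interlacing `γ`. -/
noncomputable def interlacingWeight {n : ℕ} (α : Fin (n + 1) → ℝ) (γ : Fin n → ℝ) : ℝ :=
  ∏ l, ∏ k, (Real.sqrt (1 + |α k - γ l|))⁻¹

lemma interlacingWeight_nonneg {n : ℕ} (α : Fin (n + 1) → ℝ) (γ : Fin n → ℝ) :
    0 ≤ interlacingWeight α γ := by unfold interlacingWeight; positivity

lemma exists_le_gammaRatioModel (n : ℕ) {R : ℝ} (hR : 0 ≤ R) : ∃ c : ℝ, 0 < c ∧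
    ∀ (t : ℝ) (α : Fin (n + 1) → ℝ) (β γ : Fin n → ℝ),
      (∀ l, α l.castSucc ≤ γ l) → (∀ l, γ l ≤ α l.succ) → (∀ l, |t + β l + γ l| ≤ R) →
      c * interlacingWeight α γ ≤ gammaRatioModel t α β := by
  set M : ℝ := ∏ _l : Fin n, ∏ _k : Fin (n + 1), (Real.sqrt (1 + R))⁻¹
  set T : ℝ := ∑ _l : Fin n, ∑ _k : Fin (n + 1), R + ∑ _l : Fin n, ∑ _k : Fin n, R
  -- Replacing `-(t + β)` by `γ` costs at most `1 + R` under each square root and `R` in each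
  -- distance to `α`; half the spread changes by at most `R` per ordered pair.
  refine ⟨M * Real.exp (-(Real.pi / 2 * T)), by positivity, fun t α β γ h1 h2 h3 => ?_⟩
  rw [mul_right_comm]
  refine mul_le_mul ?_ (Real.exp_le_exp.2 (neg_le_neg (mul_le_mul_of_nonneg_left ?_
    (by positivity)))) (by positivity) (by positivity)
  · rw [interlacingWeight, ← prod_mul_distrib]
    refine prod_le_prod (fun l _ => by positivity) fun l _ => ?_
    rw [← prod_mul_distrib]
    refine prod_le_prod (fun k _ => by positivity) fun k _ => ?_
    rw [← mul_inv, ← Real.sqrt_mul (by positivity)]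
    refine inv_anti₀ (Real.sqrt_pos.2 (by positivity)) (Real.sqrt_le_sqrt ?_)
    have e : t + α k + β l = (α k - γ l) + (t + β l + γ l) := by ring
    have := (abs_add_le (α k - γ l) (t + β l + γ l)).trans (add_le_add_right (h3 l) _)
    rw [e]
    nlinarith [abs_nonneg (α k - γ l)]
  · have a1 : ∑ l, ∑ k, |t + α k + β l| ≤
        ∑ l, ∑ k, |α k - γ l| + ∑ _l : Fin n, ∑ _k : Fin (n + 1), R := by
      rw [← sum_add_distrib]
      refine sum_le_sum fun l _ => ?_
      rw [← sum_add_distrib]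
      refine sum_le_sum fun k _ => ?_
      have e : t + α k + β l = (α k - γ l) + (t + β l + γ l) := by ring
      rw [e]
      exact (abs_add_le _ _).trans (add_le_add_right (h3 l) _)
    have a2 : spread γ / 2 ≤ spread β / 2 + ∑ _l : Fin n, ∑ _k : Fin n, R := by
      rw [spread, spread, sum_div, sum_div, ← sum_add_distrib]
      refine sum_le_sum fun k _ => ?_
      rw [sum_div, sum_div, ← sum_add_distrib]
      refine sum_le_sum fun l _ => ?_
      have e : γ k - γ l = (β l - β k) + ((t + β k + γ k) - (t + β l + γ l)) := by ring
      have b1 := abs_add_le (β l - β k) ((t + β k + γ k) - (t + β l + γ l))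
      have b2 := abs_sub (t + β k + γ k) (t + β l + γ l)
      rw [← e, abs_sub_comm (β l)] at b1
      linarith [h3 k, h3 l]
    rw [sum_abs_sub_of_interlacing h1 h2] at a1
    linarith

end Minorant

/-! ### The box of interlacing vectors in the middle halves of the gaps -/

section Box

open Finset

lemma prod_Ioi_eq_prod_ite {m : ℕ} (f : Fin m → Fin m → ℝ) :
    ∏ k, ∏ l ∈ Ioi k, f k l = ∏ k, ∏ l, if k < l then f k l else 1 := by
  refine prod_congr rfl fun k _ => ?_
  rw [← prod_filter]
  exact prod_congr (by ext; simp) fun _ _ => rfl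

/-- Isolates the two endpoints of the gap containing each `γ l`, and for `j < l` pairs (`α
j.castSucc`, `γ l`) with (`α l.succ`, `γ j`). Such a pair of factors then faces the single
Plancherel factor of `γ j`, `γ l`. -/
lemma prod_prod_fin_succ {n : ℕ} (g : Fin (n + 1) → Fin n → ℝ) :
    ∏ l, ∏ k, g k l = (∏ l, g l.castSucc l * g l.succ l) *
      ∏ j, ∏ l ∈ Ioi j, g j.castSucc l * g l.succ j := by
  have h (l : Fin n) : ∏ k, g k l = g l.castSucc l * g l.succ l *
      ((∏ j, if j < l then g j.castSucc l else 1) * ∏ j, if l < j then g j.succ l else 1) := by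
    have e : g l.succ l = ∏ j, if j = l then g j.succ l else 1 := by simp
    rw [Fin.prod_univ_succAbove _ l.castSucc, mul_assoc, e, ← prod_mul_distrib,
      ← prod_mul_distrib]
    congr 1
    refine prod_congr rfl fun j _ => ?_
    rcases lt_trichotomy j l with h | h | h
    · rw [Fin.succAbove_of_castSucc_lt _ _ (by simpa using h)]
      simp [h, h.ne, h.not_gt]
    · subst h
      rw [Fin.succAbove_of_le_castSucc _ _ le_rfl]
      simp
    · rw [Fin.succAbove_of_le_castSucc _ _ (by simpa using h.le)]
      simp [h, h.ne', h.not_gt]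
  simp_rw [h, prod_mul_distrib]
  rw [prod_Ioi_eq_prod_ite, prod_Ioi_eq_prod_ite, prod_comm (f := fun l j : Fin n =>
    if j < l then g j.castSucc l else 1)]

/-- For `j < l` both paired distances are at most `D = α l.succ - α j.castSucc`, while the margins
of a quarter gap force `|γ j - γ l| ≥ D / 4`, so the pair cancels the Plancherel factor up to `1/4`.
The endpoint factors leave `1 / (1 + d)` for each gap `d`, comparable to `1 / d` because `d ≥ δ`. -/
lemma exists_le_plancherelWeight_mul (n : ℕ) {δ : ℝ} (hδ : 0 < δ) : ∃ c : ℝ, 0 < c ∧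
    ∀ (α : Fin (n + 1) → ℝ) (γ : Fin n → ℝ), Monotone α →
      (∀ l : Fin n, δ ≤ α l.succ - α l.castSucc) →
      (∀ l : Fin n, α l.castSucc + (α l.succ - α l.castSucc) / 4 ≤ γ l) →
      (∀ l : Fin n, γ l ≤ α l.succ - (α l.succ - α l.castSucc) / 4) →
      c * (∏ l : Fin n, ((α l.succ - α l.castSucc) / 2)⁻¹) ≤
        interlacingWeight α γ * plancherelWeight γ := by
  refine ⟨(∏ _l : Fin n, δ / (2 * (1 + δ))) * ∏ j : Fin n, ∏ _l ∈ Ioi j, (1 / 4 : ℝ),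
    by positivity, fun α γ hα hd h1 h2 => ?_⟩
  rw [interlacingWeight, prod_prod_fin_succ, mul_right_comm, mul_assoc (∏ l : Fin n, _ * _)]
  have inv_le {a b D : ℝ} (ha : |a| ≤ D) (hb : |b| ≤ D) :
      (1 + D)⁻¹ ≤ (Real.sqrt (1 + |a|))⁻¹ * (Real.sqrt (1 + |b|))⁻¹ := by
    have hD := (abs_nonneg a).trans ha
    rw [← mul_inv]
    refine inv_anti₀ (mul_pos (Real.sqrt_pos.2 (by positivity)) (Real.sqrt_pos.2 (by positivity)))
      ?_
    calc Real.sqrt (1 + |a|) * Real.sqrt (1 + |b|) ≤ Real.sqrt (1 + D) * Real.sqrt (1 + D) := by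
          gcongr
      _ = 1 + D := Real.mul_self_sqrt (by linarith)
  refine mul_le_mul ?_ ?_ (by positivity) (by positivity)
  · rw [← prod_mul_distrib]
    refine prod_le_prod (fun l _ => ?_) fun l _ => ?_
    · have := hδ.trans_le (hd l)
      positivity
    · have h3 := h1 l
      have h4 := h2 l
      have h5 := hd l
      set d := α l.succ - α l.castSucc with hd_def
      have hd0 : 0 < d := hδ.trans_le h5
      refine le_trans ?_ (inv_le (D := d) (abs_le.2 ⟨by linarith, by linarith⟩)
        (abs_le.2 ⟨by linarith, by linarith⟩))
      rw [inv_div, div_mul_div_comm, ← one_div, div_le_div_iff₀ (by positivity) (by positivity)]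
      nlinarith
  · rw [plancherelWeight, ← prod_mul_distrib]
    refine prod_le_prod (fun j _ => by positivity) fun j _ => ?_
    rw [← prod_mul_distrib]
    refine prod_le_prod (fun l _ => by positivity) fun l hl => ?_
    have hjl : j < l := mem_Ioi.1 hl
    have h3 : α j.succ ≤ α l.castSucc := hα (Fin.le_def.2 (by simpa using hjl))
    have b1 := h1 l
    have b2 := h2 l
    have b3 := h1 j
    have b4 := h2 j
    have b5 := hd l
    have b6 := hd j
    set D := α l.succ - α j.castSucc with hD
    have hD0 : 0 < D := by linarith
    have h4 := inv_le (D := D) (a := α j.castSucc - γ l) (b := α l.succ - γ j)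
      (abs_le.2 ⟨by linarith, by linarith⟩) (abs_le.2 ⟨by linarith, by linarith⟩)
    have h5 : (1 + D) / 4 ≤ 1 + |γ j - γ l| := by
      have := neg_abs_le (γ j - γ l)
      linarith
    refine le_trans (le_of_eq ?_) (mul_le_mul h4 h5 (by positivity) (by positivity))
    field_simp

end Box

end SLMaass

namespace SLMaass

/-! ### Averaging the Weyl law over the box -/

section Averaging

open MeasureTheory Set
open scoped ENNReal Nat

/-- The pairs `(t, γ)` such that `-(t + β)`, in some order, is within `R` of `γ`. -/
def nearSet {n : ℕ} (R : ℝ) (β : Fin n → ℝ) : Set (ℝ × (Fin n → ℝ)) :=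
  {p | ∃ σ : Equiv.Perm (Fin n), ∀ l, |p.1 + β (σ l) + p.2 l| ≤ R}

lemma measurableSet_nearSet {n : ℕ} (R : ℝ) (β : Fin n → ℝ) : MeasurableSet (nearSet R β) := by
  have : nearSet R β = ⋃ σ : Equiv.Perm (Fin n), ⋂ l, {p | |p.1 + β (σ l) + p.2 l| ≤ R} := by
    ext p; simp [nearSet]
  rw [this]
  refine MeasurableSet.iUnion fun σ => MeasurableSet.iInter fun l => ?_
  exact (isClosed_le (by fun_prop) continuous_const).measurableSet

lemma volume_nearSet_le {n : ℕ} {R : ℝ} (hR : 0 ≤ R) (β : Fin n → ℝ) (t : ℝ) :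
    volume {γ | (t, γ) ∈ nearSet R β} ≤ ENNReal.ofReal (n ! * (2 * R) ^ n) := by
  have : {γ | (t, γ) ∈ nearSet R β} ⊆ ⋃ σ : Equiv.Perm (Fin n),
      Icc (fun l => -(t + β (σ l)) - R) (fun l => -(t + β (σ l)) + R) := by
    rintro γ ⟨σ, h⟩
    refine mem_iUnion.2 ⟨σ, fun l => ?_, fun l => ?_⟩
    · have := (abs_le.1 (h l)).1
      dsimp only at this ⊢; linarith
    · have := (abs_le.1 (h l)).2
      dsimp only at this ⊢; linarith
  refine (measure_mono this).trans ((measure_iUnion_fintype_le _ _).trans (le_of_eq ?_))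
  have e (σ : Equiv.Perm (Fin n)) : volume (Icc (fun l => -(t + β (σ l)) - R)
      (fun l => -(t + β (σ l)) + R)) = ENNReal.ofReal ((2 * R) ^ n) := by
    rw [Real.volume_Icc_pi, ENNReal.ofReal_pow (by positivity),
      Finset.prod_congr rfl fun l _ => by
        rw [show -(t + β (σ l)) + R - (-(t + β (σ l)) - R) = 2 * R by ring]]
    simp
  simp_rw [e]
  rw [Finset.sum_const, Finset.card_univ, Fintype.card_perm, Fintype.card_fin, nsmul_eq_mul,
    ENNReal.ofReal_mul (by positivity), ENNReal.ofReal_natCast]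

/-- Both sides come from integrating over the pairs `(t, γ)` in `nearSet R β`: integrate first in
`t` on the left and first in `γ` on the right, where `volume_nearSet_le` applies. -/
lemma lintegral_mul_volume_nearSet_le {n : ℕ} {R c : ℝ} (hR : 0 ≤ R) (hc : 0 ≤ c)
    {G : Set (Fin n → ℝ)} (hG : MeasurableSet G) {W : (Fin n → ℝ) → ℝ} (hW : Measurable W)
    {β : Fin n → ℝ} {q : ℝ → ℝ}
    (h : ∀ γ ∈ G, ∀ t, (t, γ) ∈ nearSet R β → c * W γ ≤ q t) :
    ENNReal.ofReal c * ∫⁻ γ in G, ENNReal.ofReal (W γ) * volume {t | (t, γ) ∈ nearSet R β} ≤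
      ENNReal.ofReal (n ! * (2 * R) ^ n) * ∫⁻ t, ENNReal.ofReal (q t) := by
  have hE := measurableSet_nearSet R β
  have e1 (γ : Fin n → ℝ) : ENNReal.ofReal c *
      (ENNReal.ofReal (W γ) * volume {t | (t, γ) ∈ nearSet R β}) =
      ∫⁻ t, ENNReal.ofReal (c * W γ) * (nearSet R β).indicator 1 (t, γ) := by
    rw [lintegral_const_mul' _ _ ENNReal.ofReal_ne_top, ENNReal.ofReal_mul hc, mul_assoc]
    congr 2
    exact (lintegral_indicator_one (measurable_prodMk_right hE)).symm
  have e2 (t : ℝ) : ENNReal.ofReal (q t) * volume {γ | (t, γ) ∈ nearSet R β} =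
      ∫⁻ γ, ENNReal.ofReal (q t) * (nearSet R β).indicator 1 (t, γ) := by
    rw [lintegral_const_mul' _ _ ENNReal.ofReal_ne_top]
    congr 1
    exact (lintegral_indicator_one (measurable_prodMk_left hE)).symm
  calc _ = ∫⁻ γ in G, ∫⁻ t, ENNReal.ofReal (c * W γ) * (nearSet R β).indicator 1 (t, γ) := by
        rw [← lintegral_const_mul' _ _ ENNReal.ofReal_ne_top]
        exact lintegral_congr fun γ => e1 γ
    _ = ∫⁻ t, ∫⁻ γ in G, ENNReal.ofReal (c * W γ) * (nearSet R β).indicator 1 (t, γ) := by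
        refine lintegral_lintegral_swap (Measurable.aemeasurable ?_)
        exact (ENNReal.measurable_ofReal.comp ((hW.comp measurable_fst).const_mul c)).mul
          ((measurable_one.indicator hE).comp measurable_swap)
    _ ≤ ∫⁻ t, ENNReal.ofReal (q t) * volume {γ | (t, γ) ∈ nearSet R β} := by
        refine lintegral_mono fun t => ?_
        rw [e2]
        refine (setLIntegral_mono' hG fun γ hγ => ?_).trans (setLIntegral_le_lintegral _ _)
        by_cases ht : (t, γ) ∈ nearSet R β
        · exact mul_le_mul_left (ENNReal.ofReal_le_ofReal (h γ hγ t ht)) _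
        · simp [ht]
    _ ≤ ∫⁻ t, ENNReal.ofReal (n ! * (2 * R) ^ n) * ENNReal.ofReal (q t) := by
        refine lintegral_mono fun t => ?_
        rw [mul_comm]
        exact mul_le_mul_left (volume_nearSet_le hR β t) _
    _ = _ := lintegral_const_mul' _ _ ENNReal.ofReal_ne_top

/-- The vector of sum zero that differs from `-γ` by a constant vector. -/
noncomputable def negCentered {n : ℕ} (γ : Fin n → ℝ) : Fin n → ℝ :=
  fun l => (∑ k, γ k) / n - γ l

lemma sum_negCentered {n : ℕ} (hn : 1 ≤ n) (γ : Fin n → ℝ) : ∑ l, negCentered γ l = 0 := by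
  have : (n : ℝ) ≠ 0 := by positivity
  simp [negCentered, Finset.sum_sub_distrib]
  field_simp
  simp

lemma plancherelWeight_negCentered {n : ℕ} (γ : Fin n → ℝ) :
    plancherelWeight (negCentered γ) = plancherelWeight γ := by
  refine Finset.prod_congr rfl fun k _ => Finset.prod_congr rfl fun l _ => ?_
  rw [negCentered, negCentered, abs_sub_comm (γ k)]
  congr 2
  ring

lemma one_le_volume_nearSet {n : ℕ} {K : ℝ} (β γ : Fin n → ℝ)
    (h : ∃ σ : Equiv.Perm (Fin n),
      Real.sqrt (∑ k, (β (σ k) - negCentered γ k) ^ 2) ≤ K) :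
    1 ≤ volume {t | (t, γ) ∈ nearSet (K + 1) β} := by
  obtain ⟨σ, hσ⟩ := h
  set m := (∑ k, γ k) / n with hm
  -- At `t = -m` the shift turns `t + β + γ` into `β - negCentered γ`; moving `t` by up to `1`
  -- explains the radius `K + 1`.
  have : Icc (-m) (-m + 1) ⊆ {t | (t, γ) ∈ nearSet (K + 1) β} := by
    rintro t ⟨h1, h2⟩
    refine ⟨σ, fun l => ?_⟩
    have h3 : |β (σ l) - negCentered γ l| ≤ K := by
      refine le_trans ?_ hσ
      rw [← Real.sqrt_sq_eq_abs]
      exact Real.sqrt_le_sqrt (Finset.single_le_sum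
        (f := fun k => (β (σ k) - negCentered γ k) ^ 2) (fun _ _ => sq_nonneg _)
        (Finset.mem_univ l))
    have h4 : t + β (σ l) + γ l = (β (σ l) - negCentered γ l) + (t + m) := by
      rw [negCentered]; ring
    dsimp only
    rw [h4]
    refine (abs_add_le _ _).trans (add_le_add h3 (abs_le.2 ⟨by linarith, by linarith⟩))
  refine le_trans (le_of_eq ?_) (measure_mono this)
  rw [Real.volume_Icc]
  simp

/-- Ensures that a summand of the target can vanish only when the Fourier coefficient does. -/
lemma lintegral_gammaRatio_ne_zero {n : ℕ} (α : Fin (n + 1) → ℝ) (β : Fin n → ℝ) :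
    ∫⁻ t, ENNReal.ofReal (gammaRatio t α β) ≠ 0 := by
  obtain ⟨c, hc, h⟩ := exists_le_gammaRatio n
  have hm : Measurable fun t => ENNReal.ofReal (c * gammaRatioModel t α β) := by
    unfold gammaRatioModel
    fun_prop
  have hpos (t : ℝ) : 0 < c * gammaRatioModel t α β := by
    refine mul_pos hc (mul_pos (Finset.prod_pos fun l _ => Finset.prod_pos fun k _ => ?_)
      (Real.exp_pos _))
    exact inv_pos.2 (Real.sqrt_pos.2 (by positivity))
  refine (lt_of_lt_of_le ?_ (lintegral_mono fun t => ENNReal.ofReal_le_ofReal (h t α β))).ne'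
  rw [lintegral_pos_iff_support hm, Function.support_eq_univ]
  · simp
  · exact fun t => (ENNReal.ofReal_pos.2 (hpos t)).ne'

lemma one_fourth_le_laplaceEigenvalue {n : ℕ} (hn : 1 ≤ n) (α : Fin (n + 1) → ℝ) :
    1 / 4 ≤ laplaceEigenvalue α := by
  have h1 : (1 : ℝ) ≤ n := by exact_mod_cast hn
  have h2 : 0 ≤ ∑ k, α k ^ 2 := Finset.sum_nonneg fun _ _ => sq_nonneg _
  rw [laplaceEigenvalue]
  push_cast
  nlinarith [mul_nonneg (sub_nonneg.2 h1) (sub_nonneg.2 h1), mul_nonneg (mul_nonneg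
    (sub_nonneg.2 h1) (sub_nonneg.2 h1)) (sub_nonneg.2 h1)]

/-- The analytic core, free of automorphic forms: `b` stands for the weights `|B_j(1)|²`.
Countability of `X` serves to exchange sum and integral. -/
lemma exists_lintegral_gammaRatio_lower (n : ℕ) {K C δ : ℝ} (hK : 0 ≤ K)
    (hC : 0 < C) (hδ : 0 < δ) :
    ∃ c : ℝ, 0 < c ∧ ∀ {X : Type*} [Countable X] (b : X → ℝ≥0∞) (β : X → Fin n → ℝ),
      (∀ γ : Fin n → ℝ, ENNReal.ofReal (C * plancherelWeight (negCentered γ)) ≤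
        ∑' j, b j * volume {t | (t, γ) ∈ nearSet (K + 1) (β j)}) →
      ∀ α : Fin (n + 1) → ℝ, (∀ j k, j ≠ k → δ ≤ |α j - α k|) →
        ENNReal.ofReal c ≤ ∑' j, b j * ∫⁻ t, ENNReal.ofReal (gammaRatio t α (β j)) := by
  obtain ⟨c₁, hc₁, h₁⟩ := exists_le_gammaRatio n
  obtain ⟨c₂, hc₂, h₂⟩ := exists_le_gammaRatioModel n (R := K + 1) (by linarith)
  obtain ⟨c₃, hc₃, h₃⟩ := exists_le_plancherelWeight_mul n hδ
  have hv : 0 < n ! * (2 * (K + 1)) ^ n := by positivity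
  refine ⟨c₁ * c₂ * (C * c₃) / (n ! * (2 * (K + 1)) ^ n), by positivity, ?_⟩
  intro X _ b β hX α hα
  set a := α ∘ Tuple.sort α with ha
  have hmono : Monotone a := Tuple.monotone_sort α
  have hgap (l : Fin n) : δ ≤ a l.succ - a l.castSucc := by
    rw [← abs_of_nonneg (sub_nonneg.2 (hmono (Fin.castSucc_lt_succ (i := l)).le))]
    exact hα _ _ fun h => (Fin.castSucc_lt_succ (i := l)).ne' ((Tuple.sort α).injective h)
  set lo : Fin n → ℝ := fun l => a l.castSucc + (a l.succ - a l.castSucc) / 4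
  set hi : Fin n → ℝ := fun l => a l.succ - (a l.succ - a l.castSucc) / 4
  have hG : MeasurableSet (Icc lo hi) := measurableSet_Icc
  have hW : Measurable (interlacingWeight a) := by
    unfold interlacingWeight
    fun_prop
  have hq (j : X) : ∀ γ ∈ Icc lo hi, ∀ t, (t, γ) ∈ nearSet (K + 1) (β j) →
      c₁ * c₂ * interlacingWeight a γ ≤ gammaRatio t α (β j) := by
    rintro γ ⟨hlo, hhi⟩ t ⟨σ, hσ⟩
    refine le_trans ?_ (h₁ t α (β j))
    rw [mul_assoc, ← gammaRatioModel_comp_perm t α (β j) (Tuple.sort α) σ]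
    refine mul_le_mul_of_nonneg_left (h₂ t a (β j ∘ σ) γ (fun l => ?_) (fun l => ?_) hσ) hc₁.le
    · have h4 := hlo l
      have := hgap l
      simp only [lo] at h4
      linarith
    · have h4 := hhi l
      have := hgap l
      simp only [hi] at h4
      linarith
  set d : ℝ := ∏ l : Fin n, ((a l.succ - a l.castSucc) / 2)⁻¹
  -- `d` is the reciprocal of the volume of the box, so the final bound does not depend on the gaps.
  have hvol : ENNReal.ofReal (C * c₃) =
      ENNReal.ofReal (C * c₃ * d) * volume (Icc lo hi) := by
    have hd (l : Fin n) : 0 < (a l.succ - a l.castSucc) / 2 := by linarith [hgap l]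
    rw [Real.volume_Icc_pi, ← ENNReal.ofReal_prod_of_nonneg, ← ENNReal.ofReal_mul
      (mul_nonneg (mul_pos hC hc₃).le (Finset.prod_nonneg fun l _ => (inv_pos.2 (hd l)).le)),
      mul_assoc, ← Finset.prod_mul_distrib, Finset.prod_eq_one, mul_one]
    · intro l _
      rw [show hi l - lo l = (a l.succ - a l.castSucc) / 2 by simp only [hi, lo]; ring]
      exact inv_mul_cancel₀ (hd l).ne'
    · intro l _
      rw [show hi l - lo l = (a l.succ - a l.castSucc) / 2 by simp only [hi, lo]; ring]
      exact (hd l).le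
  have hlow : ENNReal.ofReal (C * c₃) ≤ ∑' j, b j * ∫⁻ γ in Icc lo hi,
      ENNReal.ofReal (interlacingWeight a γ) *
        volume {t | (t, γ) ∈ nearSet (K + 1) (β j)} := by
    have hmeas (j : X) : Measurable fun γ : Fin n → ℝ =>
        ENNReal.ofReal (interlacingWeight a γ) * volume {t | (t, γ) ∈ nearSet (K + 1) (β j)} :=
      (ENNReal.measurable_ofReal.comp hW).mul
        (measurable_measure_prodMk_right (measurableSet_nearSet (K + 1) (β j)))
    calc _ = ∫⁻ _ in Icc lo hi, ENNReal.ofReal (C * c₃ * d) := by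
          rw [hvol, setLIntegral_const]
      _ ≤ ∫⁻ γ in Icc lo hi, ∑' j, b j * (ENNReal.ofReal (interlacingWeight a γ) *
            volume {t | (t, γ) ∈ nearSet (K + 1) (β j)}) := by
          refine setLIntegral_mono' hG fun γ hγ => ?_
          simp_rw [mul_left_comm (b _)]
          rw [ENNReal.tsum_mul_left]
          refine le_trans ?_ (mul_le_mul_right (hX γ) _)
          rw [← ENNReal.ofReal_mul (interlacingWeight_nonneg _ _), plancherelWeight_negCentered]
          refine ENNReal.ofReal_le_ofReal ?_
          have := mul_le_mul_of_nonneg_left (h₃ a γ hmono hgap hγ.1 hγ.2) hC.le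
          linarith
      _ = ∑' j, ∫⁻ γ in Icc lo hi, b j * (ENNReal.ofReal (interlacingWeight a γ) *
            volume {t | (t, γ) ∈ nearSet (K + 1) (β j)}) :=
          lintegral_tsum fun j => ((hmeas j).const_mul _).aemeasurable
      _ = _ := tsum_congr fun j => lintegral_const_mul _ (hmeas j)
  rw [ENNReal.ofReal_div_of_pos hv]
  refine ENNReal.div_le_of_le_mul' ?_
  rw [ENNReal.ofReal_mul (by positivity)]
  refine (mul_le_mul_right hlow _).trans ?_
  rw [← ENNReal.tsum_mul_left, ← ENNReal.tsum_mul_left]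
  refine ENNReal.tsum_le_tsum fun j => ?_
  rw [mul_left_comm, mul_left_comm (ENNReal.ofReal (n ! * _))]
  exact mul_le_mul_right (lintegral_mul_volume_nearSet_le (by linarith) (by positivity) hG hW
    (hq j)) _

end Averaging

end SLMaass

/-! ### Application to the Hecke–Maass basis -/

theorem proposition7p1 (n : ℕ) (hn : 1 ≤ n) (ε : ℝ) (hε : 0 < ε)
    (K : ℝ) (hK : 1 ≤ K) (C : ℝ) (hC : 0 < C) :
    ∃ c : ℝ, 0 < c ∧
      ∀ (ι : Type*) (u : ι → SLMaass.Mat n → ℂ) (β : ι → Fin n → ℝ) (B : ι → ℂ),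
        SLMaass.IsHeckeMaassBasis u →
        (∀ j, SLMaass.HasLanglandsParameters (u j) (SLMaass.imag (β j))) →
        (∀ j, SLMaass.IsFirstFourierCoeff (u j) (SLMaass.imag (β j)) (B j)) →
        SLMaass.WeightedWeylLower u β B K C →
        ∀ (F : SLMaass.Mat (n + 1) → ℂ) (α : Fin (n + 1) → ℝ),
          SLMaass.IsHeckeMaassForm F → SLMaass.IsEven F →
          SLMaass.HasLanglandsParameters F (SLMaass.imag α) →
          (∀ j k, j ≠ k → SLMaass.laplaceEigenvalue α ^ ε ≤ |α j - α k|) →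
          ENNReal.ofReal c ≤
            ∑' j : {j : ι // SLMaass.SameParity F (u j)},
              ENNReal.ofReal (‖B j.val‖ ^ 2) *
                ∫⁻ t : ℝ, ENNReal.ofReal (SLMaass.gammaRatio t α (β j.val)) := by
  -- The Laplace eigenvalue is at least `1/4`, its minimum being reached at `n = 1`, `α = 0`; hence
  -- every gap is at least `(1/4) ^ ε`.
  obtain ⟨c, hc, h⟩ := SLMaass.exists_lintegral_gammaRatio_lower n (K := K) (C := C)
    (δ := (1 / 4 : ℝ) ^ ε) (by linarith) hC (by positivity)
  refine ⟨c, hc, ?_⟩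
  intro ι u β B _ _ _ hWeyl F α _ hF _ hsep
  have hδ (j k : Fin (n + 1)) (hjk : j ≠ k) : (1 / 4 : ℝ) ^ ε ≤ |α j - α k| :=
    (Real.rpow_le_rpow (by norm_num) (SLMaass.one_fourth_le_laplaceEigenvalue hn α) hε.le).trans
      (hsep j k hjk)
  set f : {j : ι // SLMaass.SameParity F (u j)} → ENNReal := fun j =>
    ENNReal.ofReal (‖B j.val‖ ^ 2) *
      ∫⁻ t : ℝ, ENNReal.ofReal (SLMaass.gammaRatio t α (β j.val)) with hf
  -- The index type may be uncountable, but a finite sum has countable support.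
  by_cases htop : ∑' j, f j = ⊤
  · rw [htop]; exact le_top
  have hcount : (Function.support f).Countable := Summable.countable_support_ennreal htop
  have : Countable (Function.support f) := hcount.to_subtype
  refine le_trans (h (X := Function.support f) (fun j => ENNReal.ofReal (‖B j.val.val‖ ^ 2))
    (fun j => β j.val.val) (fun γ => ?_) α hδ)
    (ENNReal.tsum_comp_le_tsum_of_injective Subtype.val_injective f)
  refine (hWeyl _ (SLMaass.sum_negCentered hn γ)).trans ?_
  set g : ι → ENNReal := fun j => ENNReal.ofReal (‖B j‖ ^ 2)
  set s : Set ι := {j | SLMaass.IsEven (u j) ∧ ∃ σ : Equiv.Perm (Fin n),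
    Real.sqrt (∑ k, (β j (σ k) - SLMaass.negCentered γ k) ^ 2) ≤ K}
  set v : ι → ENNReal := fun j =>
    MeasureTheory.volume {t | (t, γ) ∈ SLMaass.nearSet (K + 1) (β j)}
  set w : {j : ι // SLMaass.SameParity F (u j)} → ENNReal := fun j => g j * v j
  -- Restricting to the support of `f` loses no Weyl mass: outside it the coefficient is zero.
  have hw : ∑' j : Function.support f, w j = ∑' j, w j := by
    refine tsum_subtype_eq_of_support_subset fun j hj hj' => hj ?_
    have : g j = 0 := (mul_eq_zero.1 hj').resolve_right
      (SLMaass.lintegral_gammaRatio_ne_zero α (β j))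
    simp only [w, this, zero_mul]
  change ∑' j : s, g j ≤ ∑' j : Function.support f, w j
  rw [hw]
  refine le_trans (ENNReal.tsum_le_tsum (g := fun j : s => g j * v j) fun j => ?_)
    (ENNReal.tsum_comp_le_tsum_of_injective
      (f := fun j : s => (⟨j.val, Or.inl ⟨hF, j.prop.1⟩⟩ :
        {j : ι // SLMaass.SameParity F (u j)}))
      (fun i j hij => Subtype.ext (congrArg (fun x => x.val) hij)) w)
  exact le_mul_of_one_le_right' (SLMaass.one_le_volume_nearSet _ _ j.prop.2)
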